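/- Let $\rho:\mathbb R\to(0,\infty)$ be a probability density and $0<\alpha\le\beta$. We say that $\rho$ is $\alpha$-strongly log-concave and $\beta$-smooth if $\log\rho$ is twice differentiable and $\alpha\le-(\log\rho)''(\theta)\le\beta$ for all $\theta\in\mathbb R$. The Gaussian approximate Fisher–Rao gradient flow for the target $\rho$ is the system $$\frac{\mathrm dm}{\mathrm dt}=C\,\mathbb E_{\mathcal N(m,C)}\big[(\log\rho)'\big],\qquad \frac{\mathrm dC}{\mathrm dt}=C+C\,\mathbb E_{\mathcal N(m,C)}\big[(\log\rho)''\big]\,C ,\qquad m\in\mathbb R,\ C>0.$$ (i) Let $\rho$ be $\alpha$-strongly log-concave and $\beta$-smooth. Then $\mathrm{KL}[\mathcal N(m,C)\,\Vert\,\rho]$ has a unique minimizer $(m_\star,C_\star)$ over $m\in\mathbb R$, $C>0$; it is a stationary point of the flow; the right-hand side of the flow is differentiable at $(m_\star,C_\star)$; its Jacobian matrix there has real eigenvalues; and the largest of them, $\lambda_{\star,\max}$, satisfies $\lambda_{\star,\max}<0$ and $$-\lambda_{\star,\max}\ \ge\ \frac{1}{\big(7+\frac{4}{\sqrt\pi}\big)\big(1+\log(\beta/\alpha)\big)}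 .$$ (ii) The bound is sharp: there are a sequence of densities $\rho_n$ and numbers $0<\alpha_n\le\beta_n$ such that $\rho_n$ is $\alpha_n$-strongly log-concave and $\beta_n$-smooth, $\beta_n/\alpha_n\to\infty$, and the corresponding largest eigenvalues $\lambda_{\star,\max,n}$ of the Jacobian matrix at the minimizer of $\mathrm{KL}[\mathcal N(m,C)\,\Vert\,\rho_n]$ satisfy $$-\lambda_{\star,\max,n}=\mathcal O\big(1/\log(\beta_n/\alpha_n)\big)\qquad(n\to\infty).$$ -/

import Mathlib

open MeasureTheory ProbabilityTheory Filter Asymptotics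
open scoped ENNReal NNReal Topology

/-- `ρ` is a strictly positive probability density on `ℝ`. -/
structure IsPositiveDensity (ρ : ℝ → ℝ) : Prop where
  pos : ∀ θ, 0 < ρ θ
  integrable : Integrable ρ
  integral_eq_one : ∫ θ, ρ θ = 1

/-- The log-density of the target. -/
noncomputable def logDensity (ρ : ℝ → ℝ) (θ : ℝ) : ℝ := Real.log (ρ θ)

/-- `ρ` is `α`-strongly log-concave: `log ρ` is twice differentiable (its second derivative need
not be continuous) and `-(log ρ)'' ≥ α` everywhere. -/
structure IsStronglyLogConcave (α : ℝ) (ρ : ℝ → ℝ) : Prop where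
  differentiable : Differentiable ℝ (logDensity ρ)
  differentiable_deriv : Differentiable ℝ (deriv (logDensity ρ))
  le_neg_deriv_deriv : ∀ θ, α ≤ -deriv (deriv (logDensity ρ)) θ

/-- The class of targets in dimension one: positive probability densities that are `α`-strongly
log-concave and satisfy `-(log ρ)'' ≤ β`. -/
structure IsTarget (α β : ℝ) (ρ : ℝ → ℝ) : Prop where
  density : IsPositiveDensity ρ
  stronglyLogConcave : IsStronglyLogConcave α ρ
  neg_deriv_deriv_le : ∀ θ, -deriv (deriv (logDensity ρ)) θ ≤ β

/-- The probability measure on `ℝ` with Lebesgue density `ρ`. -/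
noncomputable def targetMeasure (ρ : ℝ → ℝ) : Measure ℝ :=
  volume.withDensity fun θ => ENNReal.ofReal (ρ θ)

/-- The normal distribution with mean `a.1` and variance `a.2` (only used where `0 < a.2`). -/
noncomputable def gaussianOf (a : ℝ × ℝ) : Measure ℝ :=
  gaussianReal a.1 a.2.toNNReal

/-- `a = (m, C)` with `C > 0` is a minimizer of `KL[N(m, C) ‖ ρ]` among all Gaussians with
positive variance. -/
def IsGaussianVIMinimizer (ρ : ℝ → ℝ) (a : ℝ × ℝ) : Prop :=
  0 < a.2 ∧ ∀ b : ℝ × ℝ, 0 < b.2 →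
    InformationTheory.klDiv (gaussianOf a) (targetMeasure ρ) ≤
      InformationTheory.klDiv (gaussianOf b) (targetMeasure ρ)

/-- The right-hand side of the Gaussian approximate Fisher–Rao gradient flow
`m' = C 𝔼[(log ρ)']`, `C' = C + C 𝔼[(log ρ)''] C`, with expectations under `N(m, C)`. -/
noncomputable def fisherRaoField (ρ : ℝ → ℝ) (a : ℝ × ℝ) : ℝ × ℝ :=
  (a.2 * ∫ θ, deriv (logDensity ρ) θ ∂gaussianOf a,
   a.2 + a.2 * (∫ θ, deriv (deriv (logDensity ρ)) θ ∂gaussianOf a) * a.2)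

/-- `lam` is the largest eigenvalue of the linear map `J` of the plane. (If a linear map of the
real plane has one real eigenvalue, then both its eigenvalues are real.) -/
def IsLargestEigenvalue (J : (ℝ × ℝ) →L[ℝ] (ℝ × ℝ)) (lam : ℝ) : Prop :=
  IsGreatest {μ : ℝ | Module.End.HasEigenvalue (J : (ℝ × ℝ) →ₗ[ℝ] (ℝ × ℝ)) μ} lam

/-! Write V = -log ρ and realize N(m, s²) as the law of m + s z with z standard normal. Up to a
constant, the divergence is E V(m + s z) - log s. Since E z = 0 and E z² = 1, the α-strong convexity
of V passes to joint strong convexity in (m, s). A critical point is therefore the unique minimizer,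
and coercivity supplies one (`IsPotential.exists_isCritical`).

Stein's identity removes (log ρ)'' from the field, so that one differentiation under the integral
yields the Jacobian although (log ρ)'' may be discontinuous. At the minimizer g(z) = C V''(m + √C z)
has Gaussian mean 1, hence is a probability density. With μ and S its first two moments, the
Jacobian has trace -(3 + S)/2 and determinant (1 + S - μ²)/2, and the product of its off-diagonal
entries is μ²/2 ≥ 0. So the eigenvalues are real and the gap lies between determinant/|trace| and
twice that (`IsTarget.exists_isLargestEigenvalue`).

For the lower bound, μ² ≤ S leaves 1/(3 + S). As g ≤ β/α, an entropy-type inequality against E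
exp(z²/4) = √2 bounds S by 4 log(β/α) + 4√2.

For sharpness, any continuous g of mean 1 between positive bounds can be prescribed. Taking g close
to the density of N(p, 1/2) keeps S - μ² bounded while S is of order p², at condition number
exp(3p²). -/

/-- `f` is measurable and grows at most polynomially. -/
def PolyGrowth (f : ℝ → ℝ) : Prop :=
  Measurable f ∧ ∃ (K : ℝ) (k : ℕ), 0 ≤ K ∧ ∀ x, |f x| ≤ K * (1 + |x|) ^ k

/-! ### Functions of polynomial growth. -/

namespace PolyGrowth

theorem const (c : ℝ) : PolyGrowth fun _ => c :=
  ⟨measurable_const, |c|, 0, abs_nonneg c, fun _ => by simp⟩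

theorem id : PolyGrowth fun x => x :=
  ⟨measurable_id, 1, 1, zero_le_one, fun x => by simp⟩

theorem mul {f g : ℝ → ℝ} (hf : PolyGrowth f) (hg : PolyGrowth g) :
    PolyGrowth fun x => f x * g x := by
  obtain ⟨mf, K, k, hK, hf⟩ := hf
  obtain ⟨mg, K', k', hK', hg⟩ := hg
  refine ⟨mf.mul mg, K * K', k + k', mul_nonneg hK hK', fun x => ?_⟩
  rw [abs_mul]
  calc |f x| * |g x| ≤ (K * (1 + |x|) ^ k) * (K' * (1 + |x|) ^ k') :=
        mul_le_mul (hf x) (hg x) (abs_nonneg _) (by positivity)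
    _ = _ := by rw [pow_add]; ring

theorem mono {f g : ℝ → ℝ} (hf : Measurable f) (hg : PolyGrowth g) (h : ∀ x, |f x| ≤ g x) :
    PolyGrowth f := by
  obtain ⟨_, K, k, hK, hg⟩ := hg
  exact ⟨hf, K, k, hK, fun x => (h x).trans ((le_abs_self _).trans (hg x))⟩

theorem add {f g : ℝ → ℝ} (hf : PolyGrowth f) (hg : PolyGrowth g) :
    PolyGrowth fun x => f x + g x := by
  obtain ⟨mf, K, k, hK, hf⟩ := hf
  obtain ⟨mg, K', k', hK', hg⟩ := hg
  refine ⟨mf.add mg, K + K', k + k', add_nonneg hK hK', fun x => (abs_add_le _ _).trans ?_⟩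
  have h1 : (1 : ℝ) ≤ 1 + |x| := by linarith [abs_nonneg x]
  rw [add_mul]
  exact add_le_add
    ((hf x).trans (mul_le_mul_of_nonneg_left (pow_le_pow_right₀ h1 (by omega)) hK))
    ((hg x).trans (mul_le_mul_of_nonneg_left (pow_le_pow_right₀ h1 (by omega)) hK'))

theorem neg {f : ℝ → ℝ} (hf : PolyGrowth f) : PolyGrowth fun x => -f x := by
  simpa using (const (-1)).mul hf

theorem sub {f g : ℝ → ℝ} (hf : PolyGrowth f) (hg : PolyGrowth g) :
    PolyGrowth fun x => f x - g x := by
  simpa [sub_eq_add_neg] using hf.add hg.neg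

theorem pow {f : ℝ → ℝ} (hf : PolyGrowth f) (n : ℕ) : PolyGrowth fun x => f x ^ n := by
  induction n with
  | zero => simpa using const 1
  | succ n ih => simpa [pow_succ] using ih.mul hf

theorem abs {f : ℝ → ℝ} (hf : PolyGrowth f) : PolyGrowth fun x => |f x| := by
  obtain ⟨mf, K, k, hK, hf⟩ := hf
  exact ⟨mf.abs, K, k, hK, fun x => by simpa using hf x⟩

/-- The right-hand side depends on `m` and `s` only through `R`, so one integrable majorant serves a
whole ball of parameters. -/
theorem affine_bound {K : ℝ} {k : ℕ} (hK : 0 ≤ K) {f : ℝ → ℝ}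
    (hf : ∀ x, |f x| ≤ K * (1 + |x|) ^ k) {R m s : ℝ} (hm : |m| ≤ R) (hs : |s| ≤ R) (z : ℝ) :
    |f (m + s * z)| ≤ K * (1 + R) ^ k * (1 + |z|) ^ k := by
  have hR : 0 ≤ R := (abs_nonneg m).trans hm
  refine (hf _).trans ?_
  rw [mul_assoc, ← mul_pow]
  refine mul_le_mul_of_nonneg_left (pow_le_pow_left₀ (by positivity) ?_ k) hK
  have h1 := abs_add_le m (s * z)
  rw [abs_mul] at h1
  nlinarith [abs_nonneg z, mul_le_mul_of_nonneg_right hs (abs_nonneg z)]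

theorem affine {f : ℝ → ℝ} (hf : PolyGrowth f) (m s : ℝ) : PolyGrowth fun z => f (m + s * z) := by
  obtain ⟨mf, K, k, hK, hf⟩ := hf
  exact ⟨mf.comp (by fun_prop), K * (1 + max |m| |s|) ^ k, k, by positivity,
    affine_bound hK hf (le_max_left _ _) (le_max_right _ _)⟩

theorem integrable {f : ℝ → ℝ} (hf : PolyGrowth f) (m : ℝ) (v : ℝ≥0) :
    Integrable f (gaussianReal m v) := by
  obtain ⟨mf, K, k, hK, hf⟩ := hf
  have hp : Integrable (fun x : ℝ => K * (1 + |x|) ^ k) (gaussianReal m v) := by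
    refine Integrable.const_mul ?_ K
    rcases eq_or_ne k 0 with rfl | hk
    · simp
    have h0 : MemLp (fun x : ℝ => x) (k : ℝ≥0∞) (gaussianReal m v) := by
      have := memLp_id_gaussianReal (μ := m) (v := v) (k : ℝ≥0)
      rwa [ENNReal.coe_natCast] at this
    have h1 : MemLp (fun _ : ℝ => (1 : ℝ)) (k : ℝ≥0∞) (gaussianReal m v) := memLp_const 1
    have h : MemLp (fun x : ℝ => 1 + |x|) (k : ℝ≥0∞) (gaussianReal m v) := h1.add h0.norm
    refine (h.integrable_norm_pow hk).congr (ae_of_all _ fun x => ?_)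
    simp only [Real.norm_eq_abs]
    rw [abs_of_nonneg (by positivity)]
  exact hp.mono' mf.aestronglyMeasurable (ae_of_all _ hf)

/-- A function whose derivative grows at most polynomially grows at most polynomially. -/
theorem of_hasDerivAt {f f' : ℝ → ℝ} (h : ∀ x, HasDerivAt f (f' x) x) (hf' : PolyGrowth f') :
    PolyGrowth f := by
  have hm : Measurable f :=
    (continuous_iff_continuousAt.2 fun x => (h x).continuousAt).measurable
  obtain ⟨_, K, k, hK, hf'⟩ := hf'
  have key : ∀ x, |f x| ≤ |f 0| + K * (1 + |x|) ^ k * |x| := fun x => by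
    have := Convex.norm_image_sub_le_of_norm_hasDerivWithin_le (f := f) (f' := f')
      (s := Set.Icc (-|x|) |x|) (x := 0) (y := x) (C := K * (1 + |x|) ^ k)
      (fun y _ => (h y).hasDerivWithinAt)
      (fun y hy => (hf' y).trans (mul_le_mul_of_nonneg_left
        (pow_le_pow_left₀ (by positivity) (by linarith [abs_le.2 hy]) k) hK))
      (convex_Icc _ _) (by simp) (abs_le.1 le_rfl)
    rw [sub_zero, Real.norm_eq_abs, Real.norm_eq_abs] at this
    have h2 := abs_sub_abs_le_abs_sub (f x) (f 0)
    linarith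
  exact mono hm ((const |f 0|).add (((const K).mul (((const 1).add id.abs).pow k)).mul id.abs)) key

end PolyGrowth

/-! ### Gaussian averages: standardization, Stein's identity, parameter derivatives. -/

/-- The standard normal distribution. -/
noncomputable abbrev stdNormal : Measure ℝ := gaussianReal 0 1

theorem map_affine_stdNormal (m s : ℝ) :
    stdNormal.map (fun z => m + s * z) = gaussianReal m (s ^ 2).toNNReal := by
  have h : (fun z : ℝ => m + s * z) = (fun y => m + y) ∘ fun z => s * z := rfl
  rw [h, ← Measure.map_map (by fun_prop) (by fun_prop), gaussianReal_map_const_mul,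
    gaussianReal_map_const_add]
  congr 1
  · simp
  · ext; simp [Real.coe_toNNReal _ (sq_nonneg s)]

theorem integral_gaussianReal_eq_integral_affine {f : ℝ → ℝ} (hf : Measurable f) (m s : ℝ) :
    ∫ x, f x ∂gaussianReal m (s ^ 2).toNNReal = ∫ z, f (m + s * z) ∂stdNormal := by
  rw [← map_affine_stdNormal, integral_map (by fun_prop) hf.aestronglyMeasurable]

theorem integral_gaussianOf {f : ℝ → ℝ} (hf : Measurable f) {a : ℝ × ℝ} (ha : 0 ≤ a.2) :
    ∫ x, f x ∂gaussianOf a = ∫ z, f (a.1 + √a.2 * z) ∂stdNormal := by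
  rw [← integral_gaussianReal_eq_integral_affine hf, Real.sq_sqrt ha, gaussianOf]

theorem integrable_gaussianReal_iff {m : ℝ} {v : ℝ≥0} (hv : v ≠ 0) {f : ℝ → ℝ} :
    Integrable f (gaussianReal m v) ↔ Integrable fun x => gaussianPDFReal m v x * f x := by
  rw [gaussianReal_of_var_ne_zero _ hv]
  unfold gaussianPDF
  rw [integrable_withDensity_iff_integrable_smul₀' (by fun_prop) (by simp)]
  refine integrable_congr (ae_of_all _ fun x => ?_)
  simp [ENNReal.toReal_ofReal (gaussianPDFReal_nonneg m v x)]

theorem hasDerivAt_gaussianPDFReal_std (x : ℝ) :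
    HasDerivAt (gaussianPDFReal 0 1) (-x * gaussianPDFReal 0 1 x) x := by
  have h : HasDerivAt (fun y : ℝ => -(y - 0) ^ 2 / (2 * ((1 : ℝ≥0) : ℝ))) (-x) x := by
    have := ((((hasDerivAt_id x).pow 2).neg).div_const 2).congr_deriv (g' := -x)
      (by simp; ring)
    simpa using this
  have := (h.exp).const_mul ((√(2 * Real.pi * ((1 : ℝ≥0) : ℝ)))⁻¹)
  refine this.congr_deriv ?_
  rw [gaussianPDFReal]
  ring

/-- Stein's identity for the standard normal distribution. -/
theorem integral_deriv_stdNormal {f f' : ℝ → ℝ} (h : ∀ x, HasDerivAt f (f' x) x)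
    (hf' : PolyGrowth f') : ∫ z, f' z ∂stdNormal = ∫ z, f z * z ∂stdNormal := by
  have hf := PolyGrowth.of_hasDerivAt h hf'
  have i0 := (integrable_gaussianReal_iff one_ne_zero).1 (hf.integrable 0 1)
  have i1 := (integrable_gaussianReal_iff one_ne_zero).1 (hf'.integrable 0 1)
  have i2 := (integrable_gaussianReal_iff one_ne_zero).1 ((hf.mul .id).integrable 0 1)
  -- Integration by parts with φ' = -xφ; the boundary terms vanish because all the products involved
  -- are integrable.
  have key := integral_mul_deriv_eq_deriv_mul_of_integrable (u := gaussianPDFReal 0 1)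
    (u' := fun x => -x * gaussianPDFReal 0 1 x) (v := f) (v' := f')
    (fun x _ => hasDerivAt_gaussianPDFReal_std x) (fun x _ => h x) i1
    (by refine i2.neg.congr (ae_of_all _ fun x => ?_); simp; ring) i0
  rw [integral_gaussianReal_eq_integral_smul one_ne_zero,
    integral_gaussianReal_eq_integral_smul one_ne_zero]
  simp only [smul_eq_mul]
  rw [key, ← integral_neg]
  congr 1; ext x; ring

/-- Stein's identity for z ↦ f(m + s z): a derivative on f is traded for a factor z. -/
theorem mul_integral_deriv_affine {f f' : ℝ → ℝ} (h : ∀ x, HasDerivAt f (f' x) x)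
    (hf' : PolyGrowth f') (m s : ℝ) :
    s * ∫ z, f' (m + s * z) ∂stdNormal = ∫ z, f (m + s * z) * z ∂stdNormal := by
  rw [← integral_deriv_stdNormal (f' := fun z => s * f' (m + s * z)) (fun z => ?_)
    ((PolyGrowth.const s).mul (hf'.affine m s)), integral_const_mul]
  have h1 : HasDerivAt (fun y : ℝ => m + s * y) s z := by
    simpa using ((hasDerivAt_id z).const_mul s).const_add m
  rw [mul_comm]
  exact (h (m + s * z)).comp z h1

/-- Differentiation of Gaussian averages in the location and scale parameters. -/
theorem hasFDerivAt_integral_affine {f f' w : ℝ → ℝ} (h : ∀ x, HasDerivAt f (f' x) x)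
    (hf' : PolyGrowth f') (hw : PolyGrowth w) (q : ℝ × ℝ) :
    HasFDerivAt (fun q : ℝ × ℝ => ∫ z, f (q.1 + q.2 * z) * w z ∂stdNormal)
      ((∫ z, f' (q.1 + q.2 * z) * w z ∂stdNormal) • ContinuousLinearMap.fst ℝ ℝ ℝ +
        (∫ z, f' (q.1 + q.2 * z) * w z * z ∂stdNormal) • ContinuousLinearMap.snd ℝ ℝ ℝ) q := by
  have hf := PolyGrowth.of_hasDerivAt h hf'
  obtain ⟨mf', K, k, hK, hb⟩ := id hf'
  set R := ‖q‖ + 1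
  have i1 := ((hf'.affine q.1 q.2).mul hw).integrable 0 1
  have i2 := (((hf'.affine q.1 q.2).mul hw).mul .id).integrable 0 1
  -- Domination on the unit ball around `q` needs only pointwise differentiability of `f` and growth
  -- of `f'`, not continuity of `f'`.
  have key := hasFDerivAt_integral_of_dominated_of_fderiv_le (𝕜 := ℝ) (μ := stdNormal)
    (F := fun (q : ℝ × ℝ) z => f (q.1 + q.2 * z) * w z)
    (F' := fun (q : ℝ × ℝ) z => (f' (q.1 + q.2 * z) * w z) • ContinuousLinearMap.fst ℝ ℝ ℝ +
      (f' (q.1 + q.2 * z) * w z * z) • ContinuousLinearMap.snd ℝ ℝ ℝ)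
    (bound := fun z => (K * (1 + R) ^ k * (1 + |z|) ^ k) * |w z| * (1 + |z|))
    (x₀ := q) (s := Metric.ball q 1) (Metric.ball_mem_nhds q one_pos)
    (Eventually.of_forall fun q => ((hf.affine q.1 q.2).mul hw).1.aestronglyMeasurable)
    (((hf.affine q.1 q.2).mul hw).integrable 0 1)
    ((i1.smul_const (ContinuousLinearMap.fst ℝ ℝ ℝ)).add
      (i2.smul_const (ContinuousLinearMap.snd ℝ ℝ ℝ))).aestronglyMeasurable ?_
    ((((PolyGrowth.const _).mul (((PolyGrowth.const 1).add PolyGrowth.id.abs).pow k)).mul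
      hw.abs).mul ((PolyGrowth.const 1).add PolyGrowth.id.abs) |>.integrable 0 1) ?_
  · rwa [integral_add (i1.smul_const _) (i2.smul_const _), integral_smul_const,
      integral_smul_const] at key
  · refine ae_of_all _ fun z p hp => ?_
    have hp' : ‖p‖ ≤ R := by
      have h1 := norm_le_norm_add_norm_sub' p q
      rw [← dist_eq_norm] at h1
      linarith [Metric.mem_ball.1 hp]
    have hb' := PolyGrowth.affine_bound hK hb ((norm_fst_le p).trans hp')
      ((norm_snd_le p).trans hp') z
    have hm := mul_le_mul_of_nonneg_right hb' (abs_nonneg (w z))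
    refine (norm_add_le _ _).trans ?_
    rw [norm_smul, norm_smul, Real.norm_eq_abs, Real.norm_eq_abs, abs_mul, abs_mul, abs_mul]
    have e1 := ContinuousLinearMap.norm_fst_le ℝ ℝ ℝ
    have e2 := ContinuousLinearMap.norm_snd_le ℝ ℝ ℝ
    calc |f' (p.1 + p.2 * z)| * |w z| * ‖ContinuousLinearMap.fst ℝ ℝ ℝ‖ +
          |f' (p.1 + p.2 * z)| * |w z| * |z| * ‖ContinuousLinearMap.snd ℝ ℝ ℝ‖
        ≤ |f' (p.1 + p.2 * z)| * |w z| * 1 + |f' (p.1 + p.2 * z)| * |w z| * |z| * 1 := by gcongr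
      _ = |f' (p.1 + p.2 * z)| * |w z| * (1 + |z|) := by ring
      _ ≤ _ := mul_le_mul_of_nonneg_right hm (by positivity)
  · refine ae_of_all _ fun z p _ => ?_
    have h1 : HasFDerivAt (fun p : ℝ × ℝ => p.1 + p.2 * z)
        (ContinuousLinearMap.fst ℝ ℝ ℝ + z • ContinuousLinearMap.snd ℝ ℝ ℝ) p :=
      hasFDerivAt_fst.add (hasFDerivAt_snd.mul_const z)
    have h2 := ((h (p.1 + p.2 * z)).comp_hasFDerivAt p h1).mul_const (w z)
    refine h2.congr_fderiv ?_
    ext <;> simp <;> ring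

theorem integral_id_stdNormal : ∫ z, z ∂stdNormal = 0 := integral_id_gaussianReal

theorem integral_sq_gaussianReal (m : ℝ) (v : ℝ≥0) :
    ∫ z, z ^ 2 ∂gaussianReal m v = m ^ 2 + v := by
  have h := variance_eq_sub (memLp_id_gaussianReal (μ := m) (v := v) 2)
  rw [variance_id_gaussianReal] at h
  simp only [Pi.pow_apply, id, integral_id_gaussianReal] at h
  linarith

/-! ### Strongly convex potentials and the free energy. -/

/-- `V` is a potential with derivatives `V₁`, `V₂` and `α ≤ V₂ ≤ β`, where `0 < α`. -/
structure IsPotential (α β : ℝ) (V V₁ V₂ : ℝ → ℝ) : Prop where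
  pos : 0 < α
  hasDerivAt : ∀ x, HasDerivAt V (V₁ x) x
  hasDerivAt_deriv : ∀ x, HasDerivAt V₁ (V₂ x) x
  le : ∀ x, α ≤ V₂ x
  le' : ∀ x, V₂ x ≤ β

/-- The Kullback-Leibler divergence from the normal law with mean `m` and standard deviation `s` to
`exp (-V)`, up to an additive constant. -/
noncomputable def freeEnergy (V : ℝ → ℝ) (m s : ℝ) : ℝ :=
  ∫ z, V (m + s * z) ∂stdNormal - Real.log s

/-- The first-order conditions for a minimizer of the free energy. -/
structure IsCritical (V₁ V₂ : ℝ → ℝ) (m s : ℝ) : Prop where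
  pos : 0 < s
  mean : ∫ z, V₁ (m + s * z) ∂stdNormal = 0
  scale : s ^ 2 * ∫ z, V₂ (m + s * z) ∂stdNormal = 1

namespace IsPotential

variable {α β : ℝ} {V V₁ V₂ : ℝ → ℝ}

theorem polyGrowth₂ (h : IsPotential α β V V₁ V₂) : PolyGrowth V₂ := by
  have : V₂ = deriv V₁ := funext fun x => (h.hasDerivAt_deriv x).deriv.symm
  refine PolyGrowth.mono (this ▸ measurable_deriv V₁) (PolyGrowth.const β) fun x => ?_
  rw [abs_of_nonneg (h.pos.le.trans (h.le x))]
  exact h.le' x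

theorem polyGrowth₁ (h : IsPotential α β V V₁ V₂) : PolyGrowth V₁ :=
  .of_hasDerivAt h.hasDerivAt_deriv h.polyGrowth₂

theorem polyGrowth (h : IsPotential α β V V₁ V₂) : PolyGrowth V :=
  .of_hasDerivAt h.hasDerivAt h.polyGrowth₁

/-- `V₁ y - α y` is monotone, so V minus its tangent parabola at `x` decreases up to `x` and
increases after it. -/
theorem quadratic_le (h : IsPotential α β V V₁ V₂) (x y : ℝ) :
    V x + V₁ x * (y - x) + α / 2 * (y - x) ^ 2 ≤ V y := by
  have mono : Monotone fun y => V₁ y - α * y := by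
    refine monotone_of_hasDerivAt_nonneg (f' := fun y => V₂ y - α) (fun y => ?_)
      fun y => sub_nonneg.2 (h.le y)
    exact ((h.hasDerivAt_deriv y).sub ((hasDerivAt_id y).const_mul α)).congr_deriv (by simp)
  have hd : ∀ y, HasDerivAt (fun y => V y - V₁ x * (y - x) - α / 2 * (y - x) ^ 2)
      (V₁ y - V₁ x - α * (y - x)) y := fun y => by
    have h1 := (hasDerivAt_id y).sub_const x
    have := ((h.hasDerivAt y).sub (h1.const_mul (V₁ x))).sub ((h1.pow 2).const_mul (α / 2))
    refine this.congr_deriv ?_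
    simp only [id]; push_cast; ring
  have hc : Continuous fun y => V y - V₁ x * (y - x) - α / 2 * (y - x) ^ 2 :=
    continuous_iff_continuousAt.2 fun y => (hd y).continuousAt
  suffices V x - V₁ x * (x - x) - α / 2 * (x - x) ^ 2 ≤
      V y - V₁ x * (y - x) - α / 2 * (y - x) ^ 2 by
    simp only [sub_self, mul_zero, ne_eq, OfNat.ofNat_ne_zero, not_false_eq_true, zero_pow,
      sub_zero] at this
    linarith
  rcases le_total x y with hxy | hxy
  · refine monotoneOn_of_deriv_nonneg (convex_Ici x) hc.continuousOn
      (fun z _ => (hd z).differentiableAt.differentiableWithinAt) (fun z hz => ?_)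
      Set.self_mem_Ici hxy hxy
    rw [interior_Ici] at hz
    rw [(hd z).deriv]
    have := mono (le_of_lt hz)
    simp only at this
    linarith
  · refine antitoneOn_of_deriv_nonpos (convex_Iic x) hc.continuousOn
      (fun z _ => (hd z).differentiableAt.differentiableWithinAt) (fun z hz => ?_)
      hxy Set.self_mem_Iic hxy
    rw [interior_Iic] at hz
    rw [(hd z).deriv]
    have := mono (le_of_lt hz)
    simp only at this
    linarith

/-- Average the quadratic bound between m₀ + s₀ z and m + s z: E z = 0 kills the cross term, E z² =
1 gives (s - s₀)², and Stein's identity rewrites the slope in s. -/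
theorem integral_sub_quadratic_le (h : IsPotential α β V V₁ V₂) (m₀ s₀ m s : ℝ) :
    ∫ z, V (m₀ + s₀ * z) ∂stdNormal + (m - m₀) * ∫ z, V₁ (m₀ + s₀ * z) ∂stdNormal +
      (s - s₀) * (s₀ * ∫ z, V₂ (m₀ + s₀ * z) ∂stdNormal) +
      α / 2 * ((m - m₀) ^ 2 + (s - s₀) ^ 2) ≤ ∫ z, V (m + s * z) ∂stdNormal := by
  rw [mul_integral_deriv_affine h.hasDerivAt_deriv h.polyGrowth₂]
  have i0 := (h.polyGrowth.affine m₀ s₀).integrable 0 1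
  have i1 := ((h.polyGrowth₁.affine m₀ s₀).integrable 0 1).const_mul (m - m₀)
  have i2 := (((h.polyGrowth₁.affine m₀ s₀).mul .id).integrable 0 1).const_mul (s - s₀)
  have i3 : Integrable (fun _ : ℝ => α / 2 * (m - m₀) ^ 2) stdNormal := integrable_const _
  have i4 := (PolyGrowth.id.integrable 0 1).const_mul (α * (m - m₀) * (s - s₀))
  have i5 := ((PolyGrowth.id.pow 2).integrable 0 1).const_mul (α / 2 * (s - s₀) ^ 2)
  have key := integral_mono (((((i0.add i1).add i2).add i3).add i4).add i5)
    ((h.polyGrowth.affine m s).integrable 0 1) fun z => ?_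
  · rw [integral_add' ((((i0.add i1).add i2).add i3).add i4) i5,
      integral_add' (((i0.add i1).add i2).add i3) i4, integral_add' ((i0.add i1).add i2) i3,
      integral_add' (i0.add i1) i2, integral_add' i0 i1, integral_const_mul, integral_const_mul,
      integral_const_mul, integral_const_mul, integral_const_mul, integral_id_stdNormal,
      integral_sq_gaussianReal] at key
    simp only [integral_const, probReal_univ, smul_eq_mul, NNReal.coe_one] at key
    linarith
  · have := h.quadratic_le (m₀ + s₀ * z) (m + s * z)
    simp only [Pi.add_apply]
    linarith

/-- At a critical point the linear terms cancel against log(s/s₀) ≤ s/s₀ - 1. The surviving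
quadratic excess gives both minimality and uniqueness. -/
theorem _root_.IsCritical.freeEnergy_add_le (h : IsPotential α β V V₁ V₂) {m₀ s₀ : ℝ}
    (hc : IsCritical V₁ V₂ m₀ s₀) (m : ℝ) {s : ℝ} (hs : 0 < s) :
    freeEnergy V m₀ s₀ + α / 2 * ((m - m₀) ^ 2 + (s - s₀) ^ 2) ≤ freeEnergy V m s := by
  have h1 := h.integral_sub_quadratic_le m₀ s₀ m s
  have hs₀ := hc.pos
  have h2 : s₀ * ∫ z, V₂ (m₀ + s₀ * z) ∂stdNormal = 1 / s₀ := by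
    rw [eq_div_iff hs₀.ne', ← hc.scale]; ring
  have h3 := Real.log_le_sub_one_of_pos (div_pos hs hs₀)
  rw [Real.log_div hs.ne' hs₀.ne'] at h3
  have h4 : (s - s₀) * (1 / s₀) = s / s₀ - 1 := by field_simp
  rw [hc.mean, h2, h4] at h1
  unfold freeEnergy
  linarith

theorem hasFDerivAt_integral (h : IsPotential α β V V₁ V₂) (q : ℝ × ℝ) :
    HasFDerivAt (fun q : ℝ × ℝ => ∫ z, V (q.1 + q.2 * z) ∂stdNormal)
      ((∫ z, V₁ (q.1 + q.2 * z) ∂stdNormal) • ContinuousLinearMap.fst ℝ ℝ ℝ +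
        (∫ z, V₁ (q.1 + q.2 * z) * z ∂stdNormal) • ContinuousLinearMap.snd ℝ ℝ ℝ) q := by
  simpa using hasFDerivAt_integral_affine h.hasDerivAt h.polyGrowth₁ (PolyGrowth.const 1) q

theorem isCritical_of_isMinimal (h : IsPotential α β V V₁ V₂) {m₀ s₀ : ℝ} (hs₀ : 0 < s₀)
    (hmin : ∀ m s, 0 < s → freeEnergy V m₀ s₀ ≤ freeEnergy V m s) : IsCritical V₁ V₂ m₀ s₀ := by
  have hd : HasFDerivAt (fun q : ℝ × ℝ => freeEnergy V q.1 q.2) _ (m₀, s₀) :=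
    (h.hasFDerivAt_integral (m₀, s₀)).sub
      ((hasFDerivAt_snd (𝕜 := ℝ) (p := (m₀, s₀))).log hs₀.ne')
  have hl : IsLocalMin (fun q : ℝ × ℝ => freeEnergy V q.1 q.2) (m₀, s₀) := by
    filter_upwards [(isOpen_Ioi.preimage continuous_snd).mem_nhds
      (show (m₀, s₀) ∈ Prod.snd ⁻¹' Set.Ioi (0 : ℝ) from hs₀)] with q hq
    exact hmin _ _ hq
  have hz := hl.hasFDerivAt_eq_zero hd
  have h1 := DFunLike.congr_fun hz (1, 0)
  have h2 := DFunLike.congr_fun hz (0, 1)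
  simp at h1 h2
  refine ⟨hs₀, h1, ?_⟩
  rw [sq, mul_assoc, mul_integral_deriv_affine h.hasDerivAt_deriv h.polyGrowth₂,
    sub_eq_zero.1 h2, mul_inv_cancel₀ hs₀.ne']

theorem exists_isCritical (h : IsPotential α β V V₁ V₂) : ∃ m s, IsCritical V₁ V₂ m s := by
  -- The substitution s = exp t moves the problem to the whole plane, where a continuous coercive
  -- function attains its minimum.
  have hcont : Continuous fun q : ℝ × ℝ => freeEnergy V q.1 (Real.exp q.2) := by
    have h1 : Continuous fun q : ℝ × ℝ => ∫ z, V (q.1 + q.2 * z) ∂stdNormal :=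
      continuous_iff_continuousAt.2 fun q => (h.hasFDerivAt_integral q).continuousAt
    have h2 : Continuous fun q : ℝ × ℝ => (q.1, Real.exp q.2) := by fun_prop
    simp only [freeEnergy, Real.log_exp]
    exact (h1.comp h2).sub continuous_snd
  have hα := h.pos
  have hlow : ∀ q : ℝ × ℝ,
      ‖q‖ + (V 0 - (|V₁ 0| + 1) ^ 2 / (2 * α) - 2 / α) ≤ freeEnergy V q.1 (Real.exp q.2) := by
    rintro ⟨m, t⟩
    have h1 := h.integral_sub_quadratic_le 0 0 m (Real.exp t)
    simp only [zero_mul, add_zero, integral_const, probReal_univ, smul_eq_mul, one_mul, sub_zero,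
      mul_zero] at h1
    have hn : ‖(m, t)‖ ≤ |m| + |t| := by
      rw [Prod.norm_def]
      exact max_le_add_of_nonneg (abs_nonneg _) (abs_nonneg _)
    -- Completing the square, with one extra |m| kept for coercivity; `ht` does the same for t.
    have hm : |m| - (|V₁ 0| + 1) ^ 2 / (2 * α) ≤ m * V₁ 0 + α / 2 * m ^ 2 := by
      have e1 : -(|m| * |V₁ 0|) ≤ m * V₁ 0 := by rw [← abs_mul]; exact neg_abs_le _
      have e2 : 0 ≤ (α * |m| - (|V₁ 0| + 1)) ^ 2 / (2 * α) := by positivity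
      have e3 : (α * |m| - (|V₁ 0| + 1)) ^ 2 / (2 * α) =
          α / 2 * |m| ^ 2 - |m| * |V₁ 0| - |m| + (|V₁ 0| + 1) ^ 2 / (2 * α) := by
        field_simp; ring
      rw [sq_abs] at e3
      linarith
    have ht : |t| - 2 / α ≤ α / 2 * Real.exp t ^ 2 - t := by
      rcases le_total t 0 with h0 | h0
      · rw [abs_of_nonpos h0]
        have : 0 ≤ α / 2 * Real.exp t ^ 2 := by positivity
        have : 0 ≤ 2 / α := by positivity
        linarith
      · rw [abs_of_nonneg h0]
        have e1 : t ^ 2 ≤ Real.exp t ^ 2 :=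
          pow_le_pow_left₀ h0 (by linarith [Real.add_one_le_exp t]) 2
        have e2 : 0 ≤ (α * t - 2) ^ 2 / (2 * α) := by positivity
        have e3 : (α * t - 2) ^ 2 / (2 * α) = α / 2 * t ^ 2 - 2 * t + 2 / α := by
          field_simp; ring
        have e4 := mul_le_mul_of_nonneg_left e1 (half_pos hα).le
        linarith
    simp only [freeEnergy, Real.log_exp]
    linarith
  obtain ⟨⟨m, t⟩, hq⟩ := hcont.exists_forall_le
    (tendsto_atTop_mono hlow (tendsto_atTop_add_const_right _ _ tendsto_norm_cocompact_atTop))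
  refine ⟨m, Real.exp t, h.isCritical_of_isMinimal (Real.exp_pos t) fun m' s hs => ?_⟩
  simpa [Real.exp_log hs] using hq (m', Real.log s)

end IsPotential

/-! ### The divergence as a free energy. -/

section KullbackLeibler

variable {ρ : ℝ → ℝ}

theorem IsPositiveDensity.isProbabilityMeasure (h : IsPositiveDensity ρ) :
    IsProbabilityMeasure (targetMeasure ρ) := by
  refine ⟨?_⟩
  rw [targetMeasure, withDensity_apply _ MeasurableSet.univ, Measure.restrict_univ,
    ← ofReal_integral_eq_lintegral_ofReal h.integrable (ae_of_all _ fun x => (h.pos x).le),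
    h.integral_eq_one, ENNReal.ofReal_one]

theorem gaussianReal_eq_withDensity_targetMeasure (hρ : Measurable ρ) (hpos : ∀ x, 0 < ρ x)
    (m : ℝ) {v : ℝ≥0} (hv : v ≠ 0) :
    gaussianReal m v = (targetMeasure ρ).withDensity
      fun x => ENNReal.ofReal (gaussianPDFReal m v x / ρ x) := by
  rw [targetMeasure, ← withDensity_mul _ (by fun_prop) (by fun_prop),
    gaussianReal_of_var_ne_zero _ hv]
  congr 1
  ext x
  rw [Pi.mul_apply, ← ENNReal.ofReal_mul (hpos x).le, mul_div_cancel₀ _ (hpos x).ne', gaussianPDF]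

theorem log_gaussianPDFReal_affine (m : ℝ) {s : ℝ} (hs : 0 < s) (z : ℝ) :
    Real.log (gaussianPDFReal m (s ^ 2).toNNReal (m + s * z)) =
      -Real.log √(2 * Real.pi) - Real.log s - z ^ 2 / 2 := by
  rw [gaussianPDFReal, Real.coe_toNNReal _ (sq_nonneg s), Real.log_mul (by positivity)
    (Real.exp_pos _).ne', Real.log_exp, Real.log_inv, Real.sqrt_mul (by positivity),
    Real.sqrt_sq hs.le, Real.log_mul (by positivity) hs.ne']
  field_simp
  ring

/-- At m + s z the log-likelihood ratio is -log √(2π) - log s - z²/2 + V(m + s z); the final 1/2 is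
E z²/2. -/
theorem klDiv_gaussianReal_targetMeasure (h : IsPositiveDensity ρ)
    (hlog : PolyGrowth (logDensity ρ)) (m : ℝ) {s : ℝ} (hs : 0 < s) :
    InformationTheory.klDiv (gaussianReal m (s ^ 2).toNNReal) (targetMeasure ρ) ≠ ⊤ ∧
      (InformationTheory.klDiv (gaussianReal m (s ^ 2).toNNReal) (targetMeasure ρ)).toReal =
        freeEnergy (fun x => -logDensity ρ x) m s - Real.log √(2 * Real.pi) - 1 / 2 := by
  have hρ : Measurable ρ := by
    have : ρ = fun x => Real.exp (logDensity ρ x) :=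
      funext fun x => (Real.exp_log (h.pos x)).symm
    rw [this]
    exact hlog.1.exp
  have hv : (s ^ 2).toNNReal ≠ 0 := (Real.toNNReal_pos.2 (by positivity)).ne'
  have := h.isProbabilityMeasure
  have hwd := gaussianReal_eq_withDensity_targetMeasure hρ h.pos m hv
  have hac : gaussianReal m (s ^ 2).toNNReal ≪ targetMeasure ρ :=
    hwd ▸ withDensity_absolutelyContinuous _ _
  have hrn : (gaussianReal m (s ^ 2).toNNReal).rnDeriv (targetMeasure ρ)
      =ᵐ[gaussianReal m (s ^ 2).toNNReal]
        fun x => ENNReal.ofReal (gaussianPDFReal m (s ^ 2).toNNReal x / ρ x) := by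
    refine hac.ae_eq ?_
    conv_lhs => rw [hwd]
    exact Measure.rnDeriv_withDensity _ (by fun_prop)
  set F : ℝ → ℝ := fun x =>
    Real.log (gaussianPDFReal m (s ^ 2).toNNReal x) - logDensity ρ x with hF
  have hFm : Measurable F := by
    have := hlog.1
    fun_prop
  have hllr : llr (gaussianReal m (s ^ 2).toNNReal) (targetMeasure ρ)
      =ᵐ[gaussianReal m (s ^ 2).toNNReal] F := by
    filter_upwards [hrn] with x hx
    have hp := gaussianPDFReal_pos m _ x hv
    rw [llr, hx, ENNReal.toReal_ofReal (div_pos hp (h.pos x)).le,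
      Real.log_div hp.ne' (h.pos x).ne']
    rfl
  have hFa : ∀ z, F (m + s * z) =
      (-Real.log √(2 * Real.pi) - Real.log s) - 1 / 2 * z ^ 2 + -logDensity ρ (m + s * z) :=
    fun z => by simp only [hF, log_gaussianPDFReal_affine m hs]; ring
  have j1 := (PolyGrowth.const (-Real.log √(2 * Real.pi) - Real.log s)).integrable 0 1
  have j2 := ((PolyGrowth.id.pow 2).integrable 0 1).const_mul (1 / 2)
  have j3 := (hlog.neg.affine m s).integrable 0 1
  have hFi : Integrable F (gaussianReal m (s ^ 2).toNNReal) := by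
    rw [← map_affine_stdNormal,
      integrable_map_measure hFm.aestronglyMeasurable (by fun_prop)]
    exact ((j1.sub j2).add j3).congr (ae_of_all _ fun z => (hFa z).symm)
  refine ⟨InformationTheory.klDiv_ne_top hac (hFi.congr hllr.symm), ?_⟩
  rw [InformationTheory.toReal_klDiv_of_measure_eq hac (by simp), integral_congr_ae hllr,
    integral_gaussianReal_eq_integral_affine hFm]
  refine ((integral_congr_ae (ae_of_all _ hFa)).trans (integral_add (j1.sub j2) j3)).trans ?_
  rw [integral_sub j1 j2, integral_const_mul, integral_sq_gaussianReal]
  simp [freeEnergy]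
  ring

theorem klDiv_gaussianOf_le_iff (h : IsPositiveDensity ρ) (hlog : PolyGrowth (logDensity ρ))
    {a b : ℝ × ℝ} (ha : 0 < a.2) (hb : 0 < b.2) :
    InformationTheory.klDiv (gaussianOf a) (targetMeasure ρ) ≤
        InformationTheory.klDiv (gaussianOf b) (targetMeasure ρ) ↔
      freeEnergy (fun x => -logDensity ρ x) a.1 √a.2 ≤
        freeEnergy (fun x => -logDensity ρ x) b.1 √b.2 := by
  obtain ⟨a1, a2⟩ := klDiv_gaussianReal_targetMeasure h hlog a.1 (Real.sqrt_pos.2 ha)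
  obtain ⟨b1, b2⟩ := klDiv_gaussianReal_targetMeasure h hlog b.1 (Real.sqrt_pos.2 hb)
  rw [Real.sq_sqrt ha.le] at a1 a2
  rw [Real.sq_sqrt hb.le] at b1 b2
  rw [gaussianOf, gaussianOf, ← ENNReal.toReal_le_toReal a1 b1, a2, b2]
  constructor <;> intro h <;> linarith

end KullbackLeibler

/-! ### Existence and uniqueness of the minimizer. -/

theorem IsTarget.isPotential {α β : ℝ} {ρ : ℝ → ℝ} (hα : 0 < α) (h : IsTarget α β ρ) :
    IsPotential α β (fun x => -logDensity ρ x) (fun x => -deriv (logDensity ρ) x)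
      (fun x => -deriv (deriv (logDensity ρ)) x) where
  pos := hα
  hasDerivAt x := (h.stronglyLogConcave.differentiable x).hasDerivAt.neg
  hasDerivAt_deriv x := (h.stronglyLogConcave.differentiable_deriv x).hasDerivAt.neg
  le := h.stronglyLogConcave.le_neg_deriv_deriv
  le' := h.neg_deriv_deriv_le

/-- The first-order conditions at the Gaussian with mean `a.1` and variance `a.2`. -/
abbrev IsCriticalGaussian (ρ : ℝ → ℝ) (a : ℝ × ℝ) : Prop :=
  IsCritical (fun x => -deriv (logDensity ρ) x) (fun x => -deriv (deriv (logDensity ρ)) x)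
    a.1 √a.2

section Target

variable {α β : ℝ} {ρ : ℝ → ℝ} {a : ℝ × ℝ}

theorem IsTarget.polyGrowth_logDensity (hα : 0 < α) (h : IsTarget α β ρ) :
    PolyGrowth (logDensity ρ) := by
  simpa using (h.isPotential hα).polyGrowth.neg

theorem IsTarget.isGaussianVIMinimizer (hα : 0 < α) (h : IsTarget α β ρ)
    (hc : IsCriticalGaussian ρ a) : IsGaussianVIMinimizer ρ a := by
  have ha : 0 < a.2 := Real.sqrt_pos.1 hc.pos
  refine ⟨ha, fun b hb => ?_⟩
  rw [klDiv_gaussianOf_le_iff h.density (h.polyGrowth_logDensity hα) ha hb]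
  have h1 := hc.freeEnergy_add_le (h.isPotential hα) b.1 (Real.sqrt_pos.2 hb)
  have h2 : 0 ≤ α / 2 * ((b.1 - a.1) ^ 2 + (√b.2 - √a.2) ^ 2) := by positivity
  linarith

theorem IsTarget.eq_of_isGaussianVIMinimizer (hα : 0 < α) (h : IsTarget α β ρ)
    (hc : IsCriticalGaussian ρ a) {b : ℝ × ℝ} (hb : IsGaussianVIMinimizer ρ b) : b = a := by
  have ha : 0 < a.2 := Real.sqrt_pos.1 hc.pos
  have h1 := hc.freeEnergy_add_le (h.isPotential hα) b.1 (Real.sqrt_pos.2 hb.1)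
  have h2 := (klDiv_gaussianOf_le_iff h.density (h.polyGrowth_logDensity hα) hb.1 ha).1 (hb.2 a ha)
  have h3 : (b.1 - a.1) ^ 2 + (√b.2 - √a.2) ^ 2 ≤ 0 := by
    by_contra! h3
    have := mul_pos (half_pos hα) h3
    linarith
  have e1 : b.1 - a.1 = 0 := pow_eq_zero_iff two_ne_zero |>.1 (by nlinarith [sq_nonneg (b.1 - a.1)])
  have e2 : √b.2 - √a.2 = 0 :=
    pow_eq_zero_iff two_ne_zero |>.1 (by nlinarith [sq_nonneg (√b.2 - √a.2)])
  exact Prod.ext (sub_eq_zero.1 e1) ((Real.sqrt_inj hb.1.le ha.le).1 (sub_eq_zero.1 e2))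

theorem IsTarget.exists_isCriticalGaussian (hα : 0 < α) (h : IsTarget α β ρ) :
    ∃ a, IsCriticalGaussian ρ a := by
  obtain ⟨m, s, hc⟩ := (h.isPotential hα).exists_isCritical
  refine ⟨(m, s ^ 2), ?_⟩
  simpa [IsCriticalGaussian, Real.sqrt_sq hc.pos.le] using hc

end Target

/-! ### Eigenvalues of linear maps of the plane. -/

theorem hasEigenvalue_prod_iff {J : (ℝ × ℝ) →L[ℝ] (ℝ × ℝ)} {p q r t : ℝ}
    (hJ : ∀ x y, J (x, y) = (p * x + q * y, r * x + t * y)) (l : ℝ) :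
    Module.End.HasEigenvalue (J : (ℝ × ℝ) →ₗ[ℝ] (ℝ × ℝ)) l ↔ (l - p) * (l - t) = q * r := by
  constructor
  · intro h
    obtain ⟨⟨x, y⟩, hv⟩ := h.exists_hasEigenvector
    have h1 : J (x, y) = l • (x, y) := hv.apply_eq_smul
    rw [hJ, Prod.smul_mk, Prod.mk.injEq, smul_eq_mul, smul_eq_mul] at h1
    obtain ⟨e1, e2⟩ := h1
    have hx : ((l - p) * (l - t) - q * r) * x = 0 := by linear_combination -(l - t) * e1 - q * e2
    have hy : ((l - p) * (l - t) - q * r) * y = 0 := by linear_combination -(l - p) * e2 - r * e1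
    by_contra hne
    have hne' := sub_ne_zero.2 hne
    exact hv.2 (Prod.ext ((mul_eq_zero.1 hx).resolve_left hne')
      ((mul_eq_zero.1 hy).resolve_left hne'))
  · intro h
    suffices ∃ v : ℝ × ℝ, v ≠ 0 ∧ J v = l • v by
      obtain ⟨v, hv, hJv⟩ := this
      exact Module.End.hasEigenvalue_of_hasEigenvector
        (Module.End.hasEigenvector_iff.2 ⟨Module.End.mem_eigenspace_iff.2 hJv, hv⟩)
    by_cases hq : q = 0
    · by_cases hl : l = t
      · exact ⟨(0, 1), by simp, by simp [hJ, hq, hl]⟩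
      · refine ⟨(l - t, r), fun h0 => hl (sub_eq_zero.1 (congrArg Prod.fst h0)), ?_⟩
        rw [hJ, Prod.smul_mk, Prod.mk.injEq, smul_eq_mul, smul_eq_mul]
        exact ⟨by linear_combination -h, by ring⟩
    · refine ⟨(q, l - p), fun h0 => hq (congrArg Prod.fst h0), ?_⟩
      rw [hJ, Prod.smul_mk, Prod.mk.injEq, smul_eq_mul, smul_eq_mul]
      exact ⟨by ring, by linear_combination -h⟩

/-- The discriminant (p - t)² + 4qr is nonnegative, so the larger root of the characteristic
polynomial is real and at least half the trace. -/
theorem exists_isLargestEigenvalue_prod {J : (ℝ × ℝ) →L[ℝ] (ℝ × ℝ)} {p q r t : ℝ}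
    (hJ : ∀ x y, J (x, y) = (p * x + q * y, r * x + t * y)) (hqr : 0 ≤ q * r) :
    ∃ l, IsLargestEigenvalue J l ∧ l ^ 2 - (p + t) * l + (p * t - q * r) = 0 ∧ (p + t) / 2 ≤ l := by
  have hΔ : 0 ≤ (p - t) ^ 2 + 4 * (q * r) := by positivity
  have hs := Real.sq_sqrt hΔ
  refine ⟨(p + t + √((p - t) ^ 2 + 4 * (q * r))) / 2, ⟨?_, fun l hl => ?_⟩, ?_, ?_⟩
  · exact (hasEigenvalue_prod_iff hJ _).2 (by linear_combination hs / 4)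
  · have h := (hasEigenvalue_prod_iff hJ l).1 hl
    have : 2 * l - (p + t) ≤ √((p - t) ^ 2 + 4 * (q * r)) :=
      Real.le_sqrt_of_sq_le (by linarith)
    linarith
  · linear_combination hs / 4
  · linarith [Real.sqrt_nonneg ((p - t) ^ 2 + 4 * (q * r))]

/-! ### Linearization at the minimizer and the spectral gap. -/

/-- The curvature `s ^ 2 * V₂` seen by the standard normal variable, for a Gaussian with mean
`a.1` and variance `a.2`. -/
noncomputable def normalizedCurvature (ρ : ℝ → ℝ) (a : ℝ × ℝ) (z : ℝ) : ℝ :=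
  a.2 * -deriv (deriv (logDensity ρ)) (a.1 + √a.2 * z)

section Target

variable {α β : ℝ} {ρ : ℝ → ℝ} {a : ℝ × ℝ}

theorem IsTarget.polyGrowth_normalizedCurvature (hα : 0 < α) (h : IsTarget α β ρ) (a : ℝ × ℝ) :
    PolyGrowth (normalizedCurvature ρ a) :=
  (PolyGrowth.const a.2).mul ((h.isPotential hα).polyGrowth₂.affine a.1 √a.2)

/-- Stein's identity eliminates (log ρ)'', leaving averages of (log ρ)' only, which are
differentiable in (m, √C). -/
theorem IsTarget.fisherRaoField_eq (hα : 0 < α) (h : IsTarget α β ρ) (ha : 0 < a.2) :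
    fisherRaoField ρ a =
      (-(√a.2 ^ 2 * ∫ z, -deriv (logDensity ρ) (a.1 + √a.2 * z) * 1 ∂stdNormal),
        √a.2 ^ 2 - √a.2 ^ 3 * ∫ z, -deriv (logDensity ρ) (a.1 + √a.2 * z) * z ∂stdNormal) := by
  have hs := Real.sq_sqrt ha.le
  have hp := h.isPotential hα
  have e := mul_integral_deriv_affine hp.hasDerivAt_deriv hp.polyGrowth₂ a.1 √a.2
  rw [← e, fisherRaoField, integral_gaussianOf (measurable_deriv _) ha.le,
    integral_gaussianOf (measurable_deriv _) ha.le]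
  simp only [mul_one, integral_neg]
  ext
  · simp only
    linear_combination (-∫ z, deriv (logDensity ρ) (a.1 + √a.2 * z) ∂stdNormal) * hs
  · simp only
    linear_combination (-(√a.2 ^ 2 + a.2) *
      ∫ z, deriv (deriv (logDensity ρ)) (a.1 + √a.2 * z) ∂stdNormal) * hs - hs

theorem IsTarget.fisherRaoField_eq_zero (hα : 0 < α) (h : IsTarget α β ρ)
    (hc : IsCriticalGaussian ρ a) : fisherRaoField ρ a = 0 := by
  have hp := h.isPotential hα
  have ha : 0 < a.2 := Real.sqrt_pos.1 hc.pos
  have e := mul_integral_deriv_affine hp.hasDerivAt_deriv hp.polyGrowth₂ a.1 √a.2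
  rw [h.fisherRaoField_eq hα ha, ← e]
  simp only [mul_one, hc.mean, mul_zero, neg_zero]
  have := hc.scale
  ext
  · simp
  · simp only [Prod.snd_zero]
    linear_combination -√a.2 ^ 2 * this

/-- Chain rule through (m, C) ↦ (m, √C); the first-order conditions then reduce every entry to
moments of the normalized curvature. -/
theorem IsTarget.hasFDerivAt_fisherRaoField (hα : 0 < α) (h : IsTarget α β ρ)
    (hc : IsCriticalGaussian ρ a) :
    ∃ J : (ℝ × ℝ) →L[ℝ] (ℝ × ℝ), HasFDerivAt (fisherRaoField ρ) J a ∧ ∀ x y, J (x, y) =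
      (-1 * x + -((∫ z, normalizedCurvature ρ a z * z ∂stdNormal) / (2 * √a.2)) * y,
        -(√a.2 * ∫ z, normalizedCurvature ρ a z * z ∂stdNormal) * x +
          -((1 + ∫ z, normalizedCurvature ρ a z * z ^ 2 ∂stdNormal) / 2) * y) := by
  have hp := h.isPotential hα
  have hs := hc.pos
  have ha : 0 < a.2 := Real.sqrt_pos.1 hs
  have hsq := Real.sq_sqrt ha.le
  have hG := hasFDerivAt_integral_affine hp.hasDerivAt_deriv hp.polyGrowth₂ (.const 1) (a.1, √a.2)
  have hH := hasFDerivAt_integral_affine hp.hasDerivAt_deriv hp.polyGrowth₂ .id (a.1, √a.2)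
  have hsnd : HasFDerivAt (Prod.snd : ℝ × ℝ → ℝ) (ContinuousLinearMap.snd ℝ ℝ ℝ) (a.1, √a.2) :=
    hasFDerivAt_snd
  have hΦ := ((hsnd.pow 2).mul hG).neg.prodMk ((hsnd.pow 2).sub ((hsnd.pow 3).mul hH))
  have hι : HasFDerivAt (fun b : ℝ × ℝ => (b.1, √b.2))
      ((ContinuousLinearMap.fst ℝ ℝ ℝ).prod ((1 / (2 * √a.2)) • ContinuousLinearMap.snd ℝ ℝ ℝ)) a :=
    hasFDerivAt_fst.prodMk ((hasFDerivAt_snd (𝕜 := ℝ) (p := a)).sqrt ha.ne')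
  have hcomp := hΦ.comp a hι
  refine ⟨_, hcomp.congr_of_eventuallyEq ?_, fun x y => ?_⟩
  · filter_upwards [(isOpen_Ioi.preimage continuous_snd).mem_nhds
      (show a ∈ Prod.snd ⁻¹' Set.Ioi (0 : ℝ) from ha)] with b hb
    exact h.fisherRaoField_eq hα hb
  · have e := mul_integral_deriv_affine hp.hasDerivAt_deriv hp.polyGrowth₂ a.1 √a.2
    have hsc := hc.scale
    have hm := hc.mean
    have e0 : ∫ z, -deriv (deriv (logDensity ρ)) (a.1 + √a.2 * z) ∂stdNormal = 1 / √a.2 ^ 2 := by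
      rw [eq_div_iff (by positivity), ← hsc]; ring
    have e1 : ∫ z, normalizedCurvature ρ a z * z ∂stdNormal =
        √a.2 ^ 2 * ∫ z, -deriv (deriv (logDensity ρ)) (a.1 + √a.2 * z) * z ∂stdNormal := by
      rw [hsq, ← integral_const_mul]
      simp only [normalizedCurvature, mul_assoc]
    have e2 : ∫ z, normalizedCurvature ρ a z * z ^ 2 ∂stdNormal =
        √a.2 ^ 2 * ∫ z, -deriv (deriv (logDensity ρ)) (a.1 + √a.2 * z) * z * z ∂stdNormal := by
      rw [hsq, ← integral_const_mul]
      simp only [normalizedCurvature, mul_assoc, sq]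
    rw [e1, e2]
    rw [e0] at e
    simp only [mul_one] at *
    simp [-neg_mul, hm, e0, ← e]
    generalize ∫ z, -deriv (deriv (logDensity ρ)) (a.1 + √a.2 * z) * z ∂stdNormal = A
    generalize ∫ z, -deriv (deriv (logDensity ρ)) (a.1 + √a.2 * z) * z * z ∂stdNormal = B
    constructor <;> field_simp <;> ring

theorem IsTarget.integral_normalizedCurvature (hc : IsCriticalGaussian ρ a) :
    ∫ z, normalizedCurvature ρ a z ∂stdNormal = 1 := by
  have := hc.scale
  rw [Real.sq_sqrt (Real.sqrt_pos.1 hc.pos).le, ← integral_const_mul] at this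
  exact this

theorem IsTarget.le_normalizedCurvature (h : IsTarget α β ρ) (ha : 0 ≤ a.2) (z : ℝ) :
    a.2 * α ≤ normalizedCurvature ρ a z :=
  mul_le_mul_of_nonneg_left (h.stronglyLogConcave.le_neg_deriv_deriv _) ha

theorem IsTarget.normalizedCurvature_nonneg (hα : 0 < α) (h : IsTarget α β ρ) (ha : 0 ≤ a.2)
    (z : ℝ) : 0 ≤ normalizedCurvature ρ a z :=
  (mul_nonneg ha hα.le).trans (h.le_normalizedCurvature ha z)

/-- The variance of the probability density `normalizedCurvature ρ a` is nonnegative. -/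
theorem IsTarget.sq_integral_le (hα : 0 < α) (h : IsTarget α β ρ) (hc : IsCriticalGaussian ρ a) :
    (∫ z, normalizedCurvature ρ a z * z ∂stdNormal) ^ 2 ≤
      ∫ z, normalizedCurvature ρ a z * z ^ 2 ∂stdNormal := by
  have hg := h.polyGrowth_normalizedCurvature hα a
  have ha := (Real.sqrt_pos.1 hc.pos).le
  set μ := ∫ z, normalizedCurvature ρ a z * z ∂stdNormal with hμ
  have i0 := (hg.integrable 0 1).const_mul (μ ^ 2)
  have i1 := ((hg.mul .id).integrable 0 1).const_mul (2 * μ)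
  have i2 := (hg.mul (PolyGrowth.id.pow 2)).integrable 0 1
  have h0 : 0 ≤ ∫ z, normalizedCurvature ρ a z * (z - μ) ^ 2 ∂stdNormal :=
    integral_nonneg fun z => mul_nonneg (h.normalizedCurvature_nonneg hα ha z) (sq_nonneg _)
  have e : ∀ z, normalizedCurvature ρ a z * (z - μ) ^ 2 =
      normalizedCurvature ρ a z * z ^ 2 - 2 * μ * (normalizedCurvature ρ a z * z) +
        μ ^ 2 * normalizedCurvature ρ a z := fun z => by ring
  rw [(integral_congr_ae (ae_of_all _ e)).trans (integral_add (i2.sub i1) i0), integral_sub i2 i1,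
    integral_const_mul, integral_const_mul, IsTarget.integral_normalizedCurvature hc, ← hμ] at h0
  linarith

/-- Two-sided control of the largest eigenvalue of the linearized flow by the first two moments of
the probability density `normalizedCurvature ρ a`. -/
theorem IsTarget.exists_isLargestEigenvalue (hα : 0 < α) (h : IsTarget α β ρ)
    (hc : IsCriticalGaussian ρ a) {μ S : ℝ}
    (hμ : ∫ z, normalizedCurvature ρ a z * z ∂stdNormal = μ)
    (hS : ∫ z, normalizedCurvature ρ a z * z ^ 2 ∂stdNormal = S) :
    DifferentiableAt ℝ (fisherRaoField ρ) a ∧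
      ∃ l, IsLargestEigenvalue (fderiv ℝ (fisherRaoField ρ) a) l ∧
        (1 + S - μ ^ 2) / (3 + S) ≤ -l ∧ -l ≤ 2 * (1 + S - μ ^ 2) / (3 + S) := by
  have hs := hc.pos
  have hvar := h.sq_integral_le hα hc
  rw [hμ, hS] at hvar
  obtain ⟨J, hJ, hJxy⟩ := h.hasFDerivAt_fisherRaoField hα hc
  rw [hμ, hS] at hJxy
  have hqr : -(μ / (2 * √a.2)) * -(√a.2 * μ) = μ ^ 2 / 2 := by field_simp
  obtain ⟨l, hl, hq, hlow⟩ := exists_isLargestEigenvalue_prod hJxy (by rw [hqr]; positivity)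
  rw [hqr] at hq
  have hS0 : 0 < 3 + S := by nlinarith [sq_nonneg μ]
  -- The characteristic equation reads -l(3 + S)/2 = (1 + S - μ²)/2 + l². Dropping l² gives the
  -- lower bound; for the upper one, l ≤ 0 and l ≥ -(3 + S)/4 give l² ≤ -l(3 + S)/4.
  refine ⟨hJ.differentiableAt, l, hJ.fderiv.symm ▸ hl, ?_, ?_⟩
  · rw [div_le_iff₀ hS0]
    nlinarith [sq_nonneg l]
  · rw [le_div_iff₀ hS0]
    have hl0 : l ≤ 0 := by
      by_contra! hpos
      nlinarith [mul_pos hpos hS0, sq_nonneg l]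
    nlinarith [mul_nonneg (neg_nonneg.2 hl0) (sub_nonneg.2 hlow)]

theorem integrable_exp_sq_div_four : Integrable (fun z => Real.exp (z ^ 2 / 4)) stdNormal ∧
    ∫ z, Real.exp (z ^ 2 / 4) ∂stdNormal = √2 := by
  have e : ∀ z, gaussianPDFReal 0 1 z * Real.exp (z ^ 2 / 4) =
      (√(2 * Real.pi))⁻¹ * Real.exp (-(1 / 4) * z ^ 2) := fun z => by
    rw [gaussianPDFReal, mul_assoc, ← Real.exp_add]
    simp only [NNReal.coe_one, mul_one, sub_zero]
    congr 2
    ring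
  constructor
  · rw [integrable_gaussianReal_iff one_ne_zero]
    simp_rw [e]
    exact (integrable_exp_neg_mul_sq (by norm_num)).const_mul _
  · rw [integral_gaussianReal_eq_integral_smul one_ne_zero]
    simp_rw [smul_eq_mul, e]
    rw [integral_const_mul, integral_gaussian, ← Real.sqrt_inv, ← Real.sqrt_mul (by positivity)]
    congr 1
    have := Real.pi_pos
    field_simp
    norm_num

theorem IsTarget.le (h : IsTarget α β ρ) : α ≤ β :=
  (h.stronglyLogConcave.le_neg_deriv_deriv 0).trans (h.neg_deriv_deriv_le 0)

/-- The second moment of the normalized curvature grows at most logarithmically in the condition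
number. -/
theorem IsTarget.integral_normalizedCurvature_mul_sq_le (hα : 0 < α) (h : IsTarget α β ρ)
    (hc : IsCriticalGaussian ρ a) :
    ∫ z, normalizedCurvature ρ a z * z ^ 2 ∂stdNormal ≤ 4 * Real.log (β / α) + 4 * √2 := by
  have hg := h.polyGrowth_normalizedCurvature hα a
  have ha := (Real.sqrt_pos.1 hc.pos).le
  have hβ : 0 < β := hα.trans_le h.le
  have hκ : 0 < β / α := by positivity
  obtain ⟨iexp, hexp⟩ := integrable_exp_sq_div_four
  -- The curvature has mean 1, so its lower bound Cα is at most 1; hence Cβ ≤ β/α.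
  have haα : a.2 * α ≤ 1 := by
    have := integral_mono (integrable_const (a.2 * α)) (hg.integrable 0 1)
      (h.le_normalizedCurvature ha)
    rw [IsTarget.integral_normalizedCurvature hc] at this
    simpa using this
  have hup : ∀ z, normalizedCurvature ρ a z ≤ β / α := fun z => by
    rw [le_div_iff₀ hα]
    have h1 : normalizedCurvature ρ a z ≤ a.2 * β :=
      mul_le_mul_of_nonneg_left (h.neg_deriv_deriv_le _) ha
    nlinarith [mul_le_mul_of_nonneg_right h1 hα.le, mul_le_mul_of_nonneg_right haα hβ.le]
  -- With x = z²/4 and 0 ≤ g ≤ κ = β/α: g(x - log κ) ≤ g exp(x - log κ) ≤ exp x.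
  have key : ∀ z, normalizedCurvature ρ a z * z ^ 2 ≤
      4 * Real.log (β / α) * normalizedCurvature ρ a z + 4 * Real.exp (z ^ 2 / 4) := fun z => by
    have h0 := h.normalizedCurvature_nonneg hα ha z
    have h1 : z ^ 2 / 4 - Real.log (β / α) ≤ Real.exp (z ^ 2 / 4 - Real.log (β / α)) := by
      linarith [Real.add_one_le_exp (z ^ 2 / 4 - Real.log (β / α))]
    have h2 : β / α * Real.exp (z ^ 2 / 4 - Real.log (β / α)) = Real.exp (z ^ 2 / 4) := by
      rw [Real.exp_sub, Real.exp_log hκ, mul_div_cancel₀ _ hκ.ne']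
    have h3 := mul_le_mul_of_nonneg_left h1 h0
    have h4 := mul_le_mul_of_nonneg_right (hup z)
      (Real.exp_pos (z ^ 2 / 4 - Real.log (β / α))).le
    linarith
  have i1 := (hg.integrable 0 1).const_mul (4 * Real.log (β / α))
  have i2 := iexp.const_mul 4
  have := integral_mono ((hg.mul (PolyGrowth.id.pow 2)).integrable 0 1) (i1.add i2) key
  rw [integral_add' i1 i2, integral_const_mul, integral_const_mul, hexp,
    IsTarget.integral_normalizedCurvature hc] at this
  linarith

theorem IsTarget.spectral_gap (hα : 0 < α) (h : IsTarget α β ρ) (hc : IsCriticalGaussian ρ a) :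
    DifferentiableAt ℝ (fisherRaoField ρ) a ∧
      ∃ l, IsLargestEigenvalue (fderiv ℝ (fisherRaoField ρ) a) l ∧ l < 0 ∧
        -l ≥ 1 / ((7 + 4 / √Real.pi) * (1 + Real.log (β / α))) := by
  obtain ⟨hd, l, hl, hlow, -⟩ := h.exists_isLargestEigenvalue hα hc rfl rfl
  have hvar := h.sq_integral_le hα hc
  have hS := h.integral_normalizedCurvature_mul_sq_le hα hc
  set μ := ∫ z, normalizedCurvature ρ a z * z ∂stdNormal
  set S := ∫ z, normalizedCurvature ρ a z * z ^ 2 ∂stdNormal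
  have hS0 : 0 < 3 + S := by nlinarith [sq_nonneg μ]
  have hlog : 0 ≤ Real.log (β / α) := Real.log_nonneg ((one_le_div hα).2 h.le)
  have h1 : 1 / (3 + S) ≤ -l :=
    (div_le_div_of_nonneg_right (by linarith) hS0.le).trans hlow
  -- With L = log(β/α), 3 + S ≤ 3 + 4√2 + 4L ≤ 9 + 4L, while 7 + 4/√π ≥ 9.
  have hpi : 2 ≤ 4 / √Real.pi := by
    rw [le_div_iff₀ (Real.sqrt_pos.2 Real.pi_pos)]
    have : √Real.pi ≤ 2 := Real.sqrt_le_iff.2 ⟨by norm_num, by linarith [Real.pi_le_four]⟩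
    linarith
  have h2 : √2 ≤ 3 / 2 := Real.sqrt_le_iff.2 ⟨by norm_num, by norm_num⟩
  refine ⟨hd, l, hl, by linarith [one_div_pos.2 hS0], le_trans ?_ h1⟩
  refine one_div_le_one_div_of_le hS0 ?_
  nlinarith [mul_le_mul_of_nonneg_right hpi hlog]

end Target

/-! ### Targets with prescribed curvature. -/

theorem IsPotential.integrable_exp_neg {α β : ℝ} {V V₁ V₂ : ℝ → ℝ} (h : IsPotential α β V V₁ V₂) :
    Integrable fun x => Real.exp (-V x) := by
  have hα := h.pos
  refine ((integrable_exp_neg_mul_sq (b := α / 4) (by positivity)).const_mul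
    (Real.exp (V₁ 0 ^ 2 / α - V 0))).mono' h.polyGrowth.1.neg.exp.aestronglyMeasurable
    (ae_of_all _ fun x => ?_)
  rw [Real.norm_eq_abs, Real.abs_exp, ← Real.exp_add, Real.exp_le_exp]
  have h1 := h.quadratic_le 0 x
  have h2 : 0 ≤ (α * x / 2 + V₁ 0) ^ 2 / α := by positivity
  have h3 : (α * x / 2 + V₁ 0) ^ 2 / α = α / 4 * x ^ 2 + V₁ 0 * x + V₁ 0 ^ 2 / α := by
    field_simp; ring
  rw [sub_zero] at h1
  linarith

/-- A potential is, up to an additive constant, minus the logarithm of a target. -/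
theorem IsPotential.exists_isTarget {α β : ℝ} {V V₁ V₂ : ℝ → ℝ} (h : IsPotential α β V V₁ V₂) :
    ∃ ρ, IsTarget α β ρ ∧ (∀ x, deriv (logDensity ρ) x = -V₁ x) ∧
      ∀ x, deriv (deriv (logDensity ρ)) x = -V₂ x := by
  set Z := ∫ x, Real.exp (-V x) with hZ
  have hZpos : 0 < Z := integral_exp_pos h.integrable_exp_neg
  set ρ : ℝ → ℝ := fun x => Real.exp (-V x) / Z with hρ
  have hlog : logDensity ρ = fun x => -V x - Real.log Z := by
    ext x
    rw [logDensity, hρ, Real.log_div (Real.exp_pos _).ne' hZpos.ne', Real.log_exp]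
  have hd : ∀ x, HasDerivAt (logDensity ρ) (-V₁ x) x := fun x => by
    rw [hlog]; exact (h.hasDerivAt x).neg.sub_const _
  have hd1 : deriv (logDensity ρ) = fun x => -V₁ x := funext fun x => (hd x).deriv
  have hd2 : ∀ x, HasDerivAt (deriv (logDensity ρ)) (-V₂ x) x := fun x => by
    rw [hd1]; exact (h.hasDerivAt_deriv x).neg
  refine ⟨ρ, ⟨⟨fun x => by positivity, h.integrable_exp_neg.div_const Z, ?_⟩,
    ⟨fun x => (hd x).differentiableAt, fun x => (hd2 x).differentiableAt, fun x => ?_⟩,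
    fun x => ?_⟩, fun x => (hd x).deriv, fun x => (hd2 x).deriv⟩
  · rw [hρ, integral_div, ← hZ, div_self hZpos.ne']
  · rw [(hd2 x).deriv, neg_neg]; exact h.le x
  · rw [(hd2 x).deriv, neg_neg]; exact h.le' x

/-- Every continuous curvature profile of unit mean is realized by a target whose Gaussian
approximation is the standard normal law. -/
theorem exists_isTarget_of_curvature {α β : ℝ} {g : ℝ → ℝ} (hα : 0 < α) (hg : Continuous g)
    (h1 : ∀ x, α ≤ g x) (h2 : ∀ x, g x ≤ β) (hint : ∫ z, g z ∂stdNormal = 1) :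
    ∃ ρ, IsTarget α β ρ ∧ IsCriticalGaussian ρ (0, 1) ∧ normalizedCurvature ρ (0, 1) = g := by
  set W : ℝ → ℝ := fun x => ∫ t in (0 : ℝ)..x, g t
  have hW : ∀ x, HasDerivAt W (g x) x := fun x => (hg.integral_hasStrictDerivAt 0 x).hasDerivAt
  have hgp : PolyGrowth g := PolyGrowth.mono hg.measurable (PolyGrowth.const β) fun x => by
    rw [abs_of_nonneg (hα.le.trans (h1 x))]; exact h2 x
  -- The integration constant is chosen so that the first-order condition in the mean holds at (0,
  -- 1).
  set V₁ : ℝ → ℝ := fun x => W x - ∫ z, W z ∂stdNormal with hV₁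
  have hd₁ : ∀ x, HasDerivAt V₁ (g x) x := fun x => (hW x).sub_const _
  have hc₁ : Continuous V₁ := continuous_iff_continuousAt.2 fun x => (hd₁ x).continuousAt
  have hpot : IsPotential α β (fun x => ∫ t in (0 : ℝ)..x, V₁ t) V₁ g :=
    ⟨hα, fun x => (hc₁.integral_hasStrictDerivAt 0 x).hasDerivAt, hd₁, h1, h2⟩
  obtain ⟨ρ, hρ, e1, e2⟩ := hpot.exists_isTarget
  refine ⟨ρ, hρ, ⟨by simp, ?_, ?_⟩, ?_⟩
  · simp only [e1, neg_neg, Real.sqrt_one, one_mul, zero_add, hV₁]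
    rw [integral_sub ((PolyGrowth.of_hasDerivAt hW hgp).integrable 0 1) (integrable_const _)]
    simp
  · simpa [e2] using hint
  · ext z; simp [normalizedCurvature, e2]

/-! ### Sharpness: the tilted Gaussian example. -/

/-- The density of `N(p, 1/2)` with respect to the standard normal law. -/
noncomputable def gaussianTilt (p z : ℝ) : ℝ := √2 * Real.exp (p ^ 2 - (z - 2 * p) ^ 2 / 2)

theorem gaussianTilt_mul_pdf (p z : ℝ) :
    gaussianPDFReal 0 1 z * gaussianTilt p z = gaussianPDFReal p 2⁻¹ z := by
  have h : (√(2 * Real.pi))⁻¹ * √2 = (√(2 * Real.pi * 2⁻¹))⁻¹ := by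
    rw [← Real.sqrt_inv, ← Real.sqrt_inv, ← Real.sqrt_mul (by positivity)]
    congr 1
    field_simp
  rw [gaussianPDFReal, gaussianPDFReal, gaussianTilt]
  simp only [NNReal.coe_one, mul_one, sub_zero, NNReal.coe_inv, NNReal.coe_ofNat]
  rw [← h, mul_mul_mul_comm, ← Real.exp_add]
  congr 2
  ring

theorem integral_gaussianTilt_mul (p : ℝ) (f : ℝ → ℝ) :
    ∫ z, gaussianTilt p z * f z ∂stdNormal = ∫ z, f z ∂gaussianReal p 2⁻¹ := by
  rw [integral_gaussianReal_eq_integral_smul one_ne_zero,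
    integral_gaussianReal_eq_integral_smul (by norm_num)]
  simp_rw [smul_eq_mul, ← mul_assoc, gaussianTilt_mul_pdf]

theorem gaussianTilt_pos (p z : ℝ) : 0 < gaussianTilt p z := by
  unfold gaussianTilt; positivity

/-- The ratio of densities is bounded since 1/2 < 1, with its peak at z = 2p; this supplies the
upper curvature bound. -/
theorem gaussianTilt_le (p z : ℝ) : gaussianTilt p z ≤ √2 * Real.exp (p ^ 2) := by
  unfold gaussianTilt
  gcongr
  linarith [sq_nonneg (z - 2 * p)]

theorem continuous_gaussianTilt (p : ℝ) : Continuous (gaussianTilt p) := by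
  unfold gaussianTilt; fun_prop

theorem polyGrowth_gaussianTilt (p : ℝ) : PolyGrowth (gaussianTilt p) :=
  PolyGrowth.mono (continuous_gaussianTilt p).measurable (PolyGrowth.const _) fun z => by
    rw [abs_of_pos (gaussianTilt_pos p z)]; exact gaussianTilt_le p z

theorem integral_add_mul_gaussianTilt_mul (p c d : ℝ) {f : ℝ → ℝ} (hf : PolyGrowth f) :
    ∫ z, (c + d * gaussianTilt p z) * f z ∂stdNormal =
      c * ∫ z, f z ∂stdNormal + d * ∫ z, f z ∂gaussianReal p 2⁻¹ := by
  have i1 := (hf.integrable 0 1).const_mul c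
  have i2 := (((polyGrowth_gaussianTilt p).mul hf).integrable 0 1).const_mul d
  rw [← integral_gaussianTilt_mul, ← integral_const_mul, ← integral_const_mul,
    ← integral_add i1 i2]
  congr 1
  ext z
  ring

/-- Targets with logarithm of the condition number `3 * p ^ 2` and spectral gap of order
`1 / p ^ 2`. -/
theorem exists_isTarget_small_gap {p : ℝ} (hp : 1 ≤ p) :
    ∃ ρ l, IsTarget (Real.exp (-p ^ 2)) (Real.exp (2 * p ^ 2)) ρ ∧
      IsGaussianVIMinimizer ρ (0, 1) ∧ DifferentiableAt ℝ (fisherRaoField ρ) (0, 1) ∧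
      IsLargestEigenvalue (fderiv ℝ (fisherRaoField ρ) (0, 1)) l ∧ 0 ≤ -l ∧ -l ≤ 16 / p ^ 2 := by
  -- The curvature will be the density of the mixture c N(0, 1) + (1 - c) N(p, 1/2). The weight `c`
  -- keeps it bounded below, and is small enough that c p² stays bounded while log(1/c) is only p².
  set c := Real.exp (-p ^ 2) with hc
  have hp2 : 1 ≤ p ^ 2 := by nlinarith
  have hc0 : 0 < c := Real.exp_pos _
  have hcp : c * (p ^ 2 + 1) ≤ 1 := by
    calc c * (p ^ 2 + 1) ≤ c * Real.exp (p ^ 2) := by gcongr; exact Real.add_one_le_exp _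
      _ = 1 := by rw [hc, ← Real.exp_add]; simp
  have hc2 : c ≤ 1 / 2 := by nlinarith
  have hint : ∀ f : ℝ → ℝ, PolyGrowth f → ∫ z, (c + (1 - c) * gaussianTilt p z) * f z ∂stdNormal =
      c * ∫ z, f z ∂stdNormal + (1 - c) * ∫ z, f z ∂gaussianReal p 2⁻¹ :=
    fun f => integral_add_mul_gaussianTilt_mul p c (1 - c)
  have hbound : ∀ z, c + (1 - c) * gaussianTilt p z ≤ Real.exp (2 * p ^ 2) := fun z => by
    have h1 := gaussianTilt_le p z
    have h2 : √2 * Real.exp (p ^ 2) ≤ Real.exp (2 * p ^ 2) := by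
      rw [two_mul, Real.exp_add]
      gcongr
      have : √2 ≤ 2 := Real.sqrt_le_iff.2 ⟨by norm_num, by norm_num⟩
      linarith [Real.add_one_le_exp (p ^ 2)]
    have h3 : 1 ≤ Real.exp (2 * p ^ 2) := Real.one_le_exp (by positivity)
    nlinarith
  obtain ⟨ρ, hρ, hcrit, hcurv⟩ := exists_isTarget_of_curvature (α := c)
    (β := Real.exp (2 * p ^ 2)) (g := fun z => c + (1 - c) * gaussianTilt p z) hc0
    (by have := continuous_gaussianTilt p; fun_prop)
    (fun z => by nlinarith [gaussianTilt_pos p z]) hbound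
    (by simpa using hint (fun _ => 1) (.const 1))
  have hμ : ∫ z, normalizedCurvature ρ (0, 1) z * z ∂stdNormal = (1 - c) * p := by
    rw [hcurv, hint _ .id, integral_id_stdNormal, integral_id_gaussianReal]; ring
  have hS : ∫ z, normalizedCurvature ρ (0, 1) z * z ^ 2 ∂stdNormal =
      c + (1 - c) * (p ^ 2 + 1 / 2) := by
    rw [hcurv, hint _ (.pow .id 2), integral_sq_gaussianReal, integral_sq_gaussianReal]
    simp
  obtain ⟨hd, l, hl, hlow, hupp⟩ := hρ.exists_isLargestEigenvalue hc0 hcrit hμ hS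
  have hden : 0 < 3 + (c + (1 - c) * (p ^ 2 + 1 / 2)) := by nlinarith
  refine ⟨ρ, l, hρ, hρ.isGaussianVIMinimizer hc0 hcrit, hd, hl, le_trans ?_ hlow, hupp.trans ?_⟩
  · refine div_nonneg ?_ hden.le
    nlinarith [mul_nonneg hc0.le (sq_nonneg p)]
  -- The numerator 1 + S - μ² stays below 3 because c p² ≤ 1, while 3 + S ≥ p²/2 because c ≤ 1/2.
  · rw [div_le_div_iff₀ hden (by positivity)]
    have h1 : 1 + (c + (1 - c) * (p ^ 2 + 1 / 2)) - ((1 - c) * p) ^ 2 ≤ 3 := by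
      nlinarith [mul_nonneg hc0.le (sq_nonneg p), sq_nonneg (c * p)]
    have h2 : p ^ 2 / 2 ≤ 3 + (c + (1 - c) * (p ^ 2 + 1 / 2)) := by nlinarith
    nlinarith

theorem proposition4p13 :
    (∀ (α β : ℝ) (ρ : ℝ → ℝ), 0 < α → IsTarget α β ρ →
      ∃ a : ℝ × ℝ, IsGaussianVIMinimizer ρ a ∧ (∀ b, IsGaussianVIMinimizer ρ b → b = a) ∧
        fisherRaoField ρ a = 0 ∧
        DifferentiableAt ℝ (fisherRaoField ρ) a ∧
        ∃ lam : ℝ, IsLargestEigenvalue (fderiv ℝ (fisherRaoField ρ) a) lam ∧ lam < 0 ∧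
          -lam ≥ 1 / ((7 + 4 / Real.sqrt Real.pi) * (1 + Real.log (β / α)))) ∧
    (∃ (ρ : ℕ → ℝ → ℝ) (α β : ℕ → ℝ) (a : ℕ → ℝ × ℝ) (lam : ℕ → ℝ),
      (∀ n, 0 < α n ∧ IsTarget (α n) (β n) (ρ n) ∧ IsGaussianVIMinimizer (ρ n) (a n) ∧
        DifferentiableAt ℝ (fisherRaoField (ρ n)) (a n) ∧
        IsLargestEigenvalue (fderiv ℝ (fisherRaoField (ρ n)) (a n)) (lam n)) ∧
      Tendsto (fun n => β n / α n) atTop atTop ∧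
      (fun n => -lam n) =O[atTop] (fun n => 1 / Real.log (β n / α n))) := by
  constructor
  · intro α β ρ hα h
    obtain ⟨a, hc⟩ := h.exists_isCriticalGaussian hα
    exact ⟨a, h.isGaussianVIMinimizer hα hc, fun b hb => h.eq_of_isGaussianVIMinimizer hα hc hb,
      h.fisherRaoField_eq_zero hα hc, h.spectral_gap hα hc⟩
  · have hn : ∀ n : ℕ, (1 : ℝ) ≤ n + 1 := fun n => by linarith [n.cast_nonneg (α := ℝ)]
    choose ρ l h1 h2 h3 h4 h5 h6 using fun n : ℕ => exists_isTarget_small_gap (hn n)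
    have hκ : ∀ n : ℕ, Real.exp (2 * ((n : ℝ) + 1) ^ 2) / Real.exp (-((n : ℝ) + 1) ^ 2) =
        Real.exp (3 * ((n : ℝ) + 1) ^ 2) := fun n => by
      rw [← Real.exp_sub]; ring_nf
    refine ⟨ρ, fun n => Real.exp (-((n : ℝ) + 1) ^ 2), fun n => Real.exp (2 * ((n : ℝ) + 1) ^ 2),
      fun _ => (0, 1), l, fun n => ⟨Real.exp_pos _, h1 n, h2 n, h3 n, h4 n⟩, ?_, ?_⟩
    · simp_rw [hκ]
      refine Real.tendsto_exp_atTop.comp (tendsto_atTop_mono (fun n : ℕ => ?_)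
        tendsto_natCast_atTop_atTop)
      nlinarith [hn n]
    · simp_rw [hκ, Real.log_exp]
      -- 48 = 3 · 16: the logarithm of the condition number is 3p² and the gap is at most 16/p²,
      -- with p = n + 1.
      refine IsBigO.of_bound 48 (Eventually.of_forall fun n => ?_)
      have := hn n
      rw [Real.norm_of_nonneg (h5 n), Real.norm_of_nonneg (by positivity)]
      refine (h6 n).trans (le_of_eq ?_)
      field_simp
      norm_num
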